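/- **Theorem (Prandtl–Batchelor for quasi-periodic flows).** Let $D\subset\mathbb R^2$ be a bounded open set, $\mathbb T^m=(\mathbb R/2\pi\mathbb Z)^m$, and call $D\times\mathbb T^m$ the extended flow domain. A quasi-periodic flow of viscosity $\nu\ge 0$ in $D$ is a velocity field $u_q(t,x)=u(\Omega_1t,\dots,\Omega_mt,x)$, $t\in\mathbb R$, $x\in D$, where $\Omega_1,\dots,\Omega_m$ are rationally independent, $u(\theta,x)\in\mathbb R^2$ is $2\pi$-periodic in each $\theta_i$ and twice continuously differentiable in $(\theta,x)\in\mathbb R^m\times D$, and $u_q$ solves $$\partial_t u_q+(u_q\cdot\nabla)u_q=-\nabla p+\nu\Delta u_q,\qquad \operatorname{div}u_q=0\qquad\text{on }\mathbb R\times D$$ for some pressure $p$. Its vorticity is $\omega_q=\partial_1u_{q,2}-\partial_2u_{q,1}$; write also $\omega(\theta,x)=\partial_1u_2-\partial_2u_1$. Let $u_q(t,x)=u(\Omega t,x)$ be an inviscid ($\nu=0$) quasi-periodic flow in $D$. Let $(T_i)_{i\in I}$ ($I$ a linearly ordered set) be a nested family of invariant tori of this flow: each $T_i\subset D\times\mathbb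 T^m$ is an embedded $(m+1)$-dimensional torus, invariant under the tracer motion $\dot x=u(\theta,x)$, $\dot\theta=\Omega$, and contained in a level set of the vorticity $\omega$; the volume $V_i$ enclosed by $T_i$ (the union of the bounded components of the complement of $T_i$ in $\mathbb R^2\times\mathbb T^m$) lies in $D\times\mathbb T^m$; and $T_i\subset V_j$ whenever $i<j$. Suppose that this flow is a regular limit of quasi-periodic viscous flows, in the following sense. There are viscosities $\nu_k>0$ with $\nu_k\to0$, quasi-periodic flows $w_k(t,x)$ in $D$ of viscosity $\nu_k$ (with any finite number of basic frequencies, which may depend on $k$), and $\Theta_k\in\mathbb R^m$ with $\Theta_k\to\Omega$ such that, for every $i\in I$, $$w_k(t,x)-u(\Theta_kt,x)\to0\quad\text{and}\quad \operatorname{curl}w_k(t,x)-\omega(\Theta_kt,x)\to0\qquad(k\to\infty),$$ uniformly over all $t\in\mathbb R$ and all $x$ with $(x,\Theta_kt\bmod 2\pi)\in T_i\cup V_i$. (For $\Theta_k=\Omega$ this says that the viscous parts of velocity and vorticity tend to zero; a general $\Theta_k\to\Omega$ lets the frequencies vary with the viscosity.) Then the vorticity of the inviscid flow is uniform across the tori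 and in the region enclosed by them: there is a constant $c$ with $\omega(\theta,x)=c$ for all $i\in I$ and all $(x,\theta)\in T_i\cup V_i$. -/

import Mathlib

open Filter Topology

/-- The Euclidean plane. -/
abbrev Plane : Type := EuclideanSpace ℝ (Fin 2)

/-- Partial derivative `∂v_j/∂x_i` of a planar vector field. -/
noncomputable def partialDeriv (v : Plane → Plane) (i j : Fin 2) (x : Plane) : ℝ :=
  fderiv ℝ v x (EuclideanSpace.single i 1) j

/-- Divergence `∂v₁/∂x₁ + ∂v₂/∂x₂`. -/
noncomputable def planarDivergence (v : Plane → Plane) (x : Plane) : ℝ :=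
  partialDeriv v 0 0 x + partialDeriv v 1 1 x

/-- Scalar vorticity `∂v₂/∂x₁ - ∂v₁/∂x₂`. -/
noncomputable def vorticity (v : Plane → Plane) (x : Plane) : ℝ :=
  partialDeriv v 0 1 x - partialDeriv v 1 0 x

/-- The time-dependent velocity field `v t x` is a classical solution, for all times and on `D`, of
the incompressible Navier-Stokes equations with viscosity `ν` (and constant density, absorbed in
the pressure):
`∂v/∂t + (v · ∇) v = -∇p + ν Δv`, `div v = 0`. For `ν = 0` these are the Euler equations. -/
def SolvesNavierStokes (ν : ℝ) (D : Set Plane) (v : ℝ → Plane → Plane) : Prop :=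
  (∀ t, ∀ x ∈ D, planarDivergence (v t) x = 0) ∧
  ∃ p : ℝ → Plane → ℝ, ∀ t, ∀ x ∈ D, DifferentiableAt ℝ (p t) x ∧
    deriv (fun s => v s x) t + fderiv ℝ (v t) x (v t x) =
      -gradient (p t) x + ν • Laplacian.laplacian (v t) x

/-- The profile `u θ x` on `ℝ^m × D` and the frequencies `Ω` define the quasi-periodic
incompressible flow `u_q(t, x) = u(Ω₁ t, …, Ω_m t, x)` of viscosity `ν` in `D`. -/
structure IsQuasiPeriodicFlow (ν : ℝ) (D : Set Plane) {m : ℕ} (Ω : Fin m → ℝ)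
    (u : (Fin m → ℝ) → Plane → Plane) : Prop where
  rationally_independent : LinearIndependent ℚ Ω
  periodic : ∀ (θ : Fin m → ℝ) (i : Fin m), ∀ x ∈ D,
    u (θ + Pi.single i (2 * Real.pi)) x = u θ x
  contDiffOn : ContDiffOn ℝ 2 (fun q : (Fin m → ℝ) × Plane => u q.1 q.2) (Set.univ ×ˢ D)
  solves : SolvesNavierStokes ν D (fun t => u (t • Ω))

/-- The standard torus of dimension `n`, a product of `n` circles `ℝ/2πℤ`. -/
noncomputable abbrev StdTorus (n : ℕ) : Type := Fin n → AddCircle (2 * Real.pi)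

/-- The product of the plane with the `m`-torus of phases; the extended flow domain `D × 𝕋^m` is
the set of its points whose first component is in `D`. -/
noncomputable abbrev ExtendedSpace (m : ℕ) : Type := Plane × StdTorus m

/-- Reduction of a phase vector modulo `2π`. -/
noncomputable def phase {m : ℕ} (θ : Fin m → ℝ) : StdTorus m := fun i => (θ i : AddCircle (2 * Real.pi))

/-- The volume enclosed by a set `T`: the union of the bounded connected components of the
complement of `T` (the torus of phases is compact, so only the planar component can be
unbounded). -/
def enclosedRegion {m : ℕ} (T : Set (ExtendedSpace m)) : Set (ExtendedSpace m) :=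
  {p | p ∈ Tᶜ ∧ Bornology.IsBounded (Prod.fst '' connectedComponentIn Tᶜ p)}

/-- `T` together with the volume enclosed by it. -/
def filledRegion {m : ℕ} (T : Set (ExtendedSpace m)) : Set (ExtendedSpace m) :=
  T ∪ enclosedRegion T

/-- `T` is an embedded `(m+1)`-dimensional torus. -/
def IsEmbeddedTorus {m : ℕ} (T : Set (ExtendedSpace m)) : Prop :=
  ∃ f : StdTorus (m + 1) → ExtendedSpace m,
    Continuous f ∧ Function.Injective f ∧ Set.range f = T

/-- `T` is invariant under the tracer motion `x' = u(θ, x)`, `θ' = Ω` in the extended flow domain: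
every trajectory, on any time interval `I` containing `0`, which is on `T` at time `0` is on `T` at
all times of `I`. -/
def IsInvariantSet (D : Set Plane) {m : ℕ} (Ω : Fin m → ℝ)
    (u : (Fin m → ℝ) → Plane → Plane) (T : Set (ExtendedSpace m)) : Prop :=
  ∀ (θ : Fin m → ℝ) (I : Set ℝ) (x : ℝ → Plane), I.OrdConnected → (0 : ℝ) ∈ I →
    (∀ t ∈ I, x t ∈ D ∧ HasDerivWithinAt x (u (θ + t • Ω) (x t)) I t) →
    (x 0, phase θ) ∈ T → ∀ t ∈ I, (x t, phase (θ + t • Ω)) ∈ T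

/-- A nested family of invariant tori, each contained in a level set of the vorticity, whose
enclosed volumes are contained in the extended flow domain. -/
structure IsNestedFamilyOfInvariantTori (D : Set Plane) {m : ℕ} (Ω : Fin m → ℝ)
    (u : (Fin m → ℝ) → Plane → Plane) {ι : Type*} [LinearOrder ι]
    (T : ι → Set (ExtendedSpace m)) : Prop where
  torus : ∀ i, IsEmbeddedTorus (T i)
  subset_domain : ∀ i, ∀ q ∈ filledRegion (T i), q.1 ∈ D
  invariant : ∀ i, IsInvariantSet D Ω u (T i)
  in_level_set : ∀ i, ∃ c : ℝ, ∀ (θ : Fin m → ℝ) (x : Plane),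
    (x, phase θ) ∈ T i → vorticity (u θ) x = c
  nested : ∀ i j, i < j → T i ⊆ enclosedRegion (T j)

/-- Regular limit on a set `R` of the extended flow domain. The velocity of the `k`-th flow of the
sequence `w` is written as `w k t x = u(t Θ_k, x) + (remainder)`, and the remainder and its
vorticity tend to zero, uniformly over all times and all points `x` with `(x, t Θ_k) ∈ R`. For
`Θ_k = Ω` the first summand is the flow `u(Ω t, x)` itself; a sequence `Θ_k → Ω` lets the
frequencies drift with the viscosity. -/
def IsRegularLimitOn {m : ℕ} (u : (Fin m → ℝ) → Plane → Plane)
    (Θ : ℕ → Fin m → ℝ) (w : ℕ → ℝ → Plane → Plane) (R : Set (ExtendedSpace m)) : Prop :=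
  ∀ ε : ℝ, 0 < ε → ∀ᶠ k in atTop, ∀ (t : ℝ) (x : Plane), (x, phase (t • Θ k)) ∈ R →
    ‖w k t x - u (t • Θ k) x‖ < ε ∧
    |vorticity (w k t) x - vorticity (u (t • Θ k)) x| < ε

/-! Viscous vorticity obeys an advection–diffusion equation with no source, so it satisfies a
maximum principle; as the flow exists for all times, no initial data enter and the values on the
lateral boundary alone control it. For flow `k`, the points (t, x) with (x, tΘ_k) in a filled torus
form a closed spacetime tube whose lateral part lies over T. There the inviscid vorticity equals c,
so curl w_k is within ε of c on the lateral part, hence on the whole tube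
(`vorticity_le_of_boundary_le`, applied to ±vorticity). The inviscid vorticity is then within 2ε of
c along the phases tΘ_k. Letting k → ∞ at fixed t gives the value c along the orbit tΩ; Kronecker's
theorem and continuity give it at all phases. Nesting identifies the constants of different tori.

Since the velocity is only C², the vorticity is only C¹ and its Laplacian is unavailable. The
second-order condition at a maximum is obtained from fluxes instead: by the momentum equation, the
flux of ν∇ω through a circle equals that of the rotated acceleration
(`integral_fderiv_vorticity_circleDir`), which is differentiable with divergence equal to the
material derivative of ω. `trace_nonpos_of_isLocalMax` turns this into a sign. The barrier
δ(exp(αx₁) − κ√(1 + t²)) makes the inequality strict and forces a maximum to exist on the unbounded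
time axis. -/

/-! ### Topology of the phase torus and of filled regions. -/

theorem isOpenQuotientMap_phase (m : ℕ) :
    IsOpenQuotientMap (phase : (Fin m → ℝ) → StdTorus m) :=
  IsOpenQuotientMap.piMap fun _ => QuotientAddGroup.isOpenQuotientMap_mk

theorem continuous_phase (m : ℕ) : Continuous (phase : (Fin m → ℝ) → StdTorus m) :=
  (isOpenQuotientMap_phase m).continuous

/-- Makes components of open subsets of the extended space open. -/
instance AddCircle.locallyConnectedSpace (p : ℝ) : LocallyConnectedSpace (AddCircle p) :=
  (QuotientAddGroup.isOpenQuotientMap_mk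
    (N := AddSubgroup.zmultiples p)).isQuotientMap.isCoinducing.locallyConnectedSpace

section FilledRegion

variable {m : ℕ} {T : Set (ExtendedSpace m)}

/-- A subset of `Tᶜ` that is a union of components of the open set `Tᶜ` is open. -/
theorem isOpen_of_connectedComponentIn_invariant (hT : IsClosed T)
    (P : Set (ExtendedSpace m) → Prop) :
    IsOpen {p | p ∈ Tᶜ ∧ P (connectedComponentIn Tᶜ p)} := by
  rw [isOpen_iff_mem_nhds]
  rintro p ⟨hp, hP⟩
  filter_upwards [(hT.isOpen_compl.connectedComponentIn (x := p)).mem_nhds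
    (mem_connectedComponentIn hp)] with q hq
  exact ⟨connectedComponentIn_subset _ _ hq, by rwa [← connectedComponentIn_eq hq]⟩

theorem isOpen_enclosedRegion (hT : IsClosed T) : IsOpen (enclosedRegion T) :=
  isOpen_of_connectedComponentIn_invariant hT fun s => Bornology.IsBounded (Prod.fst '' s)

/-- The complement is the union of the unbounded components, open for the same reason as the union
of the bounded ones. -/
theorem isClosed_filledRegion (hT : IsClosed T) : IsClosed (filledRegion T) := by
  have h : (filledRegion T)ᶜ =
      {p | p ∈ Tᶜ ∧ ¬ Bornology.IsBounded (Prod.fst '' connectedComponentIn Tᶜ p)} := by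
    ext p
    simp only [filledRegion, enclosedRegion, Set.mem_compl_iff, Set.mem_union, Set.mem_ofPred_eq]
    tauto
  rw [← isOpen_compl_iff, h]
  exact isOpen_of_connectedComponentIn_invariant hT fun s => ¬ Bornology.IsBounded (Prod.fst '' s)

theorem IsEmbeddedTorus.isClosed (hT : IsEmbeddedTorus T) : IsClosed T := by
  obtain ⟨f, hf, -, rfl⟩ := hT
  have : Fact (0 < 2 * Real.pi) := ⟨Real.two_pi_pos⟩
  exact (isCompact_range hf).isClosed

theorem IsEmbeddedTorus.nonempty (hT : IsEmbeddedTorus T) : T.Nonempty := by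
  obtain ⟨f, -, -, rfl⟩ := hT
  exact Set.range_nonempty f

end FilledRegion

/-! ### Kronecker's density theorem via Fourier coefficients of invariant measures. -/

section Kronecker

open MeasureTheory UnitAddTorus

theorem mFourier_add_point {d : Type*} [Fintype d] (n : d → ℤ) (x y : UnitAddTorus d) :
    mFourier n (x + y) = mFourier n x * mFourier n y := by
  simp only [mFourier, ContinuousMap.coe_mk, Pi.add_apply, ← Finset.prod_mul_distrib]
  refine Finset.prod_congr rfl fun i _ => ?_
  simp [fourier_apply, smul_add, AddCircle.toCircle_add]

theorem mFourier_coe {d : Type*} [Fintype d] (n : d → ℤ) (a : d → ℝ) :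
    mFourier n (fun i => (a i : AddCircle (1 : ℝ))) =
      Complex.exp (2 * Real.pi * Complex.I * (∑ i, (n i : ℝ) * a i : ℝ)) := by
  simp only [mFourier, ContinuousMap.coe_mk, fourier_coe_apply]
  rw [← Complex.exp_sum]
  congr 1
  push_cast
  rw [Finset.mul_sum]
  exact Finset.sum_congr rfl fun i _ => by ring

/-- If a probability measure on the torus is invariant under the translations along a line with
rationally independent slopes, its nonconstant Fourier coefficients vanish. -/
theorem integral_mFourier_of_invariant {d : Type*} [Fintype d] {a : d → ℝ}
    (ha : LinearIndependent ℚ a) (μ : Measure (UnitAddTorus d)) [IsProbabilityMeasure μ]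
    (hμ : ∀ t : ℝ, μ.map (· + fun i => ((t * a i : ℝ) : AddCircle (1 : ℝ))) = μ) (n : d → ℤ) :
    ∫ x, mFourier n x ∂μ = if n = 0 then 1 else 0 := by
  split_ifs with hn
  · subst hn
    simp [mFourier_zero]
  · have hs : ∑ i, (n i : ℝ) * a i ≠ 0 := by
      intro h0
      apply hn
      have := Fintype.linearIndependent_iff.1 ha (fun i => (n i : ℚ)) (by
        rw [← h0]; exact Finset.sum_congr rfl fun i _ => by simp [Rat.smul_def])
      exact funext fun i => by exact_mod_cast this i
    obtain ⟨s, hs'⟩ : ∃ s, ∑ i, (n i : ℝ) * a i = s := ⟨_, rfl⟩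
    rw [hs'] at hs
    -- Translation by time 1/(2s) multiplies the character by exp(πi) = −1, so the integral is its
    -- own negative.
    have key : ∫ x, mFourier n x ∂μ =
        (∫ x, mFourier n x ∂μ) *
          mFourier n (fun i => (((1 / (2 * s)) * a i : ℝ) : AddCircle (1 : ℝ))) := by
      conv_lhs => rw [← hμ (1 / (2 * s))]
      rw [integral_map (by fun_prop) (by fun_prop), ← integral_mul_const]
      simp only [mFourier_add_point]
    have hval : mFourier n (fun i => (((1 / (2 * s)) * a i : ℝ) : AddCircle (1 : ℝ))) = -1 := by
      rw [mFourier_coe]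
      have : ∑ i, (n i : ℝ) * (1 / (2 * s) * a i) = 1 / 2 := by
        have h2 : ∑ i, (n i : ℝ) * (1 / (2 * s) * a i) = (1 / (2 * s)) * ∑ i, (n i : ℝ) * a i := by
          rw [Finset.mul_sum]
          exact Finset.sum_congr rfl fun i _ => by ring
        rw [h2, hs']
        field_simp
      rw [this, ← Complex.exp_pi_mul_I]
      congr 1
      push_cast
      ring
    rw [hval] at key
    linear_combination key / 2

/-- Both measures have the same Fourier coefficients; trigonometric polynomials are dense in the
continuous functions, and integration against a probability measure is 1-Lipschitz in the sup norm.
-/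
theorem integral_eq_of_invariant {d : Type*} [Fintype d] {a : d → ℝ}
    (ha : LinearIndependent ℚ a) (μ μ' : Measure (UnitAddTorus d)) [IsProbabilityMeasure μ]
    [IsProbabilityMeasure μ']
    (hμ : ∀ t : ℝ, μ.map (· + fun i => ((t * a i : ℝ) : AddCircle (1 : ℝ))) = μ)
    (hμ' : ∀ t : ℝ, μ'.map (· + fun i => ((t * a i : ℝ) : AddCircle (1 : ℝ))) = μ')
    (f : C(UnitAddTorus d, ℂ)) : ∫ x, f x ∂μ = ∫ x, f x ∂μ' := by
  have hint : ∀ (ρ : Measure (UnitAddTorus d)) [IsProbabilityMeasure ρ] (g : C(UnitAddTorus d, ℂ)),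
      Integrable g ρ := fun ρ _ g =>
    (integrableOn_univ (μ := ρ)).1 (g.continuous.continuousOn.integrableOn_compact isCompact_univ)
  have hcont : ∀ (ρ : Measure (UnitAddTorus d)) [IsProbabilityMeasure ρ],
      Continuous fun g : C(UnitAddTorus d, ℂ) => ∫ x, g x ∂ρ := fun ρ _ => by
    refine (LipschitzWith.of_dist_le_mul (K := 1) fun g h => ?_).continuous
    rw [dist_eq_norm, ← integral_sub (hint ρ g) (hint ρ h), NNReal.coe_one, one_mul, dist_eq_norm]
    simpa using norm_integral_le_of_norm_le_const (μ := ρ)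
      (ae_of_all _ fun x => (g - h).norm_coe_le_norm x)
  have hmem : f ∈ (Submodule.span ℂ (Set.range <| mFourier (d := d))).topologicalClosure := by
    rw [span_mFourier_closure_eq_top]; trivial
  refine closure_minimal (t := {g : C(UnitAddTorus d, ℂ) | ∫ x, g x ∂μ = ∫ x, g x ∂μ'}) ?_
    (isClosed_eq (hcont μ) (hcont μ')) hmem
  intro g hg
  induction hg using Submodule.span_induction with
  | mem g hg =>
    obtain ⟨n, rfl⟩ := hg
    simp only [Set.mem_ofPred_eq]
    rw [integral_mFourier_of_invariant ha μ hμ, integral_mFourier_of_invariant ha μ' hμ']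
  | zero => simp
  | add g h _ _ hg hh =>
    simp only [Set.mem_ofPred_eq, ContinuousMap.add_apply] at *
    rw [integral_add (hint _ _) (hint _ _), integral_add (hint _ _) (hint _ _), hg, hh]
  | smul c g _ hg =>
    simp only [Set.mem_ofPred_eq, ContinuousMap.smul_apply] at *
    rw [integral_smul, integral_smul, hg]

/-- **Kronecker's theorem**: a line with rationally independent slopes is dense in the torus. -/
theorem denseRange_line_unitAddTorus {d : Type*} [Fintype d] {a : d → ℝ}
    (ha : LinearIndependent ℚ a) :
    DenseRange fun (t : ℝ) (i : d) => ((t * a i : ℝ) : AddCircle (1 : ℝ)) := by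
  let φ : ℝ →+ UnitAddTorus d :=
    { toFun := fun t i => ((t * a i : ℝ) : AddCircle (1 : ℝ))
      map_zero' := by ext i; simp
      map_add' := fun s t => by ext i; simp [add_mul] }
  let H : AddSubgroup (UnitAddTorus d) := φ.range.topologicalClosure
  have hHc : IsClosed (H : Set (UnitAddTorus d)) := φ.range.isClosed_topologicalClosure
  have hφH : ∀ t, φ t ∈ H := fun t => φ.range.le_topologicalClosure ⟨t, rfl⟩
  have : CompactSpace H := isCompact_iff_compactSpace.1 hHc.isCompact
  -- Haar measure on the closure `H` of the line, pushed to the torus, and Haar measure of the torus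
  -- are both invariant along the line. A Urysohn function vanishing on `H` would separate them if
  -- `H` were proper.
  let ρ : Measure H := Measure.addHaarMeasure ⊤
  have : IsProbabilityMeasure ρ := ⟨by
    simpa using Measure.addHaarMeasure_self (K₀ := (⊤ : TopologicalSpace.PositiveCompacts H))⟩
  let μ₀ : Measure (UnitAddTorus d) := Measure.addHaarMeasure ⊤
  have : IsProbabilityMeasure μ₀ := ⟨by
    simpa using
      Measure.addHaarMeasure_self (K₀ := (⊤ : TopologicalSpace.PositiveCompacts (UnitAddTorus d)))⟩
  have hval : Measurable (Subtype.val : H → UnitAddTorus d) := measurable_subtype_coe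
  have : IsProbabilityMeasure (ρ.map Subtype.val) :=
    Measure.isProbabilityMeasure_map hval.aemeasurable
  have h1 : ∀ t : ℝ, (ρ.map Subtype.val).map
      (· + fun i => ((t * a i : ℝ) : AddCircle (1 : ℝ))) = ρ.map Subtype.val := fun t => by
    rw [Measure.map_map (by fun_prop) hval]
    conv_rhs => rw [← map_add_right_eq_self ρ ⟨φ t, hφH t⟩]
    rw [Measure.map_map hval (by fun_prop)]
    rfl
  have h2 : ∀ t : ℝ, μ₀.map
      (· + fun i => ((t * a i : ℝ) : AddCircle (1 : ℝ))) = μ₀ := fun t =>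
    map_add_right_eq_self _ _
  have hdense : (H : Set (UnitAddTorus d)) = Set.univ := by
    by_contra hne
    obtain ⟨y, hy⟩ := (Set.ne_univ_iff_exists_notMem _).1 hne
    obtain ⟨f, hf0, hf1, hf⟩ := exists_continuous_zero_one_of_isClosed hHc
      (isClosed_singleton (x := y)) (Set.disjoint_singleton_right.2 hy)
    let g : C(UnitAddTorus d, ℂ) := ⟨fun x => (f x : ℂ), by fun_prop⟩
    have hg := integral_eq_of_invariant ha (ρ.map Subtype.val) μ₀ h1 h2 g
    have e1 : ∫ x, g x ∂(ρ.map Subtype.val) = 0 := by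
      rw [integral_map hval.aemeasurable (by fun_prop)]
      refine integral_eq_zero_of_ae (ae_of_all _ fun x => ?_)
      simp [g, hf0 x.2]
    have e2 : 0 < ∫ x, f x ∂μ₀ := by
      refine f.continuous.integral_pos_of_hasCompactSupport_nonneg_nonzero
        (HasCompactSupport.of_compactSpace _) (fun x => (hf x).1) (x := y) ?_
      rw [hf1 rfl]
      exact one_ne_zero
    rw [e1] at hg
    have : ∫ x, g x ∂μ₀ = ((∫ x, f x ∂μ₀ : ℝ) : ℂ) := integral_ofReal
    rw [this] at hg
    exact e2.ne (by exact_mod_cast hg)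
  rw [DenseRange, dense_iff_closure_eq]
  exact hdense

theorem denseRange_phase_line {m : ℕ} {Ω : Fin m → ℝ} (hΩ : LinearIndependent ℚ Ω) :
    DenseRange fun t : ℝ => phase (t • Ω) := by
  let h : UnitAddTorus (Fin m) ≃ₜ StdTorus m := Homeomorph.piCongrRight fun _ =>
    AddCircle.homeomorphAddCircle 1 (2 * Real.pi) one_ne_zero Real.two_pi_pos.ne'
  have := h.surjective.denseRange.comp (denseRange_line_unitAddTorus hΩ) h.continuous
  refine this.mono ?_
  rintro _ ⟨t, rfl⟩
  -- Passing from circles of length 1 to length 2π rescales time by 2π.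
  refine ⟨2 * Real.pi * t, ?_⟩
  ext i
  simp only [phase, Function.comp, h, Homeomorph.piCongrRight_apply, Pi.smul_apply, smul_eq_mul,
    AddCircle.homeomorphAddCircle_apply_mk]
  congr 1
  ring

end Kronecker

/-! ### Fluxes through small circles and local maxima. -/

section PlanarCalculus

open MeasureTheory

/-- The point of the unit circle at angle `φ`. -/
noncomputable def circleDir (φ : ℝ) : Plane := !₂[Real.cos φ, Real.sin φ]

theorem continuous_circleDir : Continuous circleDir := by
  unfold circleDir
  fun_prop

theorem continuous_add_smul_circleDir (x : Plane) (r : ℝ) :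
    Continuous fun φ => x + r • circleDir φ := by
  have := continuous_circleDir
  fun_prop

theorem norm_circleDir (φ : ℝ) : ‖circleDir φ‖ = 1 := by
  simp [circleDir, EuclideanSpace.norm_eq, Fin.sum_univ_two]

theorem inner_circleDir (v : Plane) (φ : ℝ) :
    inner ℝ v (circleDir φ) = v 0 * Real.cos φ + v 1 * Real.sin φ := by
  simp [circleDir, PiLp.inner_apply, Fin.sum_univ_two, mul_comm]

theorem circleDir_eq (φ : ℝ) : circleDir φ =
    Real.cos φ • EuclideanSpace.single 0 1 + Real.sin φ • EuclideanSpace.single 1 1 := by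
  ext i
  fin_cases i <;> simp [circleDir]

theorem add_smul_circleDir_mem_ball (x₀ : Plane) {s ρ : ℝ} (hs : 0 ≤ s) (hsρ : s < ρ) (φ : ℝ) :
    x₀ + s • circleDir φ ∈ Metric.ball x₀ ρ := by
  simp [norm_smul, norm_circleDir, abs_of_nonneg hs, hsρ]

/-- The flux through the circle of radius `s` of an affine vector field with linear part `L`. -/
theorem integral_inner_affine_circleDir (v : Plane) (L : Plane →L[ℝ] Plane) (s c : ℝ) :
    ∫ φ in (0 : ℝ)..2 * Real.pi,
      (inner ℝ (v + s • L (circleDir φ)) (circleDir φ) + c) =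
      s * Real.pi * (L (EuclideanSpace.single 0 1) 0 + L (EuclideanSpace.single 1 1) 1)
        + 2 * Real.pi * c := by
  have h : ∀ φ, inner ℝ (v + s • L (circleDir φ)) (circleDir φ) + c =
      v 0 * Real.cos φ + v 1 * Real.sin φ
      + s * L (EuclideanSpace.single 0 1) 0 * Real.cos φ ^ 2
      + s * L (EuclideanSpace.single 1 1) 1 * Real.sin φ ^ 2
      + s * (L (EuclideanSpace.single 1 1) 0 + L (EuclideanSpace.single 0 1) 1)
        * (Real.sin φ * Real.cos φ) + c := fun φ => by
    rw [inner_circleDir, circleDir_eq]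
    simp only [map_add, map_smul, PiLp.add_apply, PiLp.smul_apply, smul_eq_mul]
    ring
  simp only [h]
  have i1 : ∀ f : ℝ → ℝ, Continuous f → IntervalIntegrable f volume 0 (2 * Real.pi) :=
    fun f hf => hf.intervalIntegrable _ _
  rw [intervalIntegral.integral_add (i1 _ (by fun_prop)) (i1 _ (by fun_prop)),
    intervalIntegral.integral_add (i1 _ (by fun_prop)) (i1 _ (by fun_prop)),
    intervalIntegral.integral_add (i1 _ (by fun_prop)) (i1 _ (by fun_prop)),
    intervalIntegral.integral_add (i1 _ (by fun_prop)) (i1 _ (by fun_prop)),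
    intervalIntegral.integral_add (i1 _ (by fun_prop)) (i1 _ (by fun_prop))]
  simp only [intervalIntegral.integral_const_mul, integral_cos_sq, integral_sin_sq, integral_cos,
    integral_sin, integral_sin_mul_cos₁, intervalIntegral.integral_const]
  simp
  ring

/-- The average growth of a function along the rays to a circle is the integral of its fluxes
through the concentric circles. -/
theorem integral_flux_eq {G : Plane → ℝ} {x₀ : Plane} {r ρ : ℝ} (hr : 0 < r) (hrρ : r < ρ)
    (hG : ∀ x ∈ Metric.ball x₀ ρ, DifferentiableAt ℝ G x)
    (hG' : ContinuousOn (fderiv ℝ G) (Metric.ball x₀ ρ)) :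
    ∃ J : ℝ → ℝ, Continuous J ∧
      (∀ s ∈ Set.Ioo 0 r, J s = ∫ φ in (0 : ℝ)..2 * Real.pi,
        fderiv ℝ G (x₀ + s • circleDir φ) (circleDir φ)) ∧
      ∫ s in (0 : ℝ)..r, J s =
        ∫ φ in (0 : ℝ)..2 * Real.pi, (G (x₀ + r • circleDir φ) - G x₀) := by
  -- Clamping the radius to [0, r] keeps the point in the ball, so `K` is continuous everywhere.
  let K : ℝ → ℝ → ℝ := fun s φ =>
    fderiv ℝ G (x₀ + (max 0 (min s r)) • circleDir φ) (circleDir φ)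
  have hmem : ∀ s φ : ℝ, x₀ + (max 0 (min s r)) • circleDir φ ∈ Metric.ball x₀ ρ := fun s φ =>
    add_smul_circleDir_mem_ball x₀ (le_max_left _ _)
      ((max_le hr.le (min_le_right _ _)).trans_lt hrρ) φ
  have hK : Continuous (Function.uncurry K) := by
    have hc := continuous_circleDir
    have : Continuous fun q : ℝ × ℝ => x₀ + (max 0 (min q.1 r)) • circleDir q.2 := by fun_prop
    exact (hG'.comp_continuous this fun q => hmem q.1 q.2).clm_apply (hc.comp continuous_snd)
  have hKeq : ∀ s ∈ Set.Icc 0 r, ∀ φ, K s φ =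
      fderiv ℝ G (x₀ + s • circleDir φ) (circleDir φ) := fun s hs φ => by
    simp only [K, min_eq_left hs.2, max_eq_right hs.1]
  refine ⟨fun s => ∫ φ in (0 : ℝ)..2 * Real.pi, K s φ,
    intervalIntegral.continuous_parametric_intervalIntegral_of_continuous' hK _ _, ?_, ?_⟩
  · intro s hs
    simp only [hKeq s ⟨hs.1.le, hs.2.le⟩]
  · rw [intervalIntegral_intervalIntegral_swap]
    · refine intervalIntegral.integral_congr fun φ _ => ?_
      have hd : ∀ s ∈ Set.uIcc 0 r, HasDerivAt (fun s => G (x₀ + s • circleDir φ)) (K s φ) s := by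
        intro s hs
        rw [Set.uIcc_of_le hr.le] at hs
        rw [hKeq s hs]
        have h1 : HasDerivAt (fun s : ℝ => x₀ + s • circleDir φ) (circleDir φ) s := by
          simpa using ((hasDerivAt_id s).smul_const (circleDir φ)).const_add x₀
        exact (hG _ (add_smul_circleDir_mem_ball x₀ hs.1
          (hs.2.trans_lt hrρ) φ)).hasFDerivAt.comp_hasDerivAt s h1
      have hKφ : Continuous fun s => K s φ := hK.comp (by fun_prop : Continuous fun s => (s, φ))
      simpa using intervalIntegral.integral_eq_sub_of_hasDerivAt hd (hKφ.intervalIntegrable _ _)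
    · exact (hK.continuousOn.integrableOn_compact
        (isCompact_uIcc.prod isCompact_uIcc)).mono_set
        (Set.prod_mono Set.uIoc_subset_uIcc Set.uIoc_subset_uIcc)

/-- If the gradient of `G` has the same flux through small circles about a local maximum of `G` as
a vector field `F` which is differentiable there, then the divergence of `F` is not positive. -/
theorem trace_nonpos_of_isLocalMax {G : Plane → ℝ} {F : Plane → Plane} {L : Plane →L[ℝ] Plane}
    {x₀ : Plane} {ρ : ℝ} (hρ : 0 < ρ)
    (hG : ∀ x ∈ Metric.ball x₀ ρ, DifferentiableAt ℝ G x)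
    (hG' : ContinuousOn (fderiv ℝ G) (Metric.ball x₀ ρ)) (hmax : IsLocalMax G x₀)
    (hF : HasFDerivAt F L x₀) (hFc : ContinuousOn F (Metric.ball x₀ ρ))
    (hflux : ∀ r ∈ Set.Ioo 0 ρ,
      ∫ φ in (0 : ℝ)..2 * Real.pi, fderiv ℝ G (x₀ + r • circleDir φ) (circleDir φ) =
        ∫ φ in (0 : ℝ)..2 * Real.pi, inner ℝ (F (x₀ + r • circleDir φ)) (circleDir φ)) :
    L (EuclideanSpace.single 0 1) 0 + L (EuclideanSpace.single 1 1) 1 ≤ 0 := by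
  by_contra! hpos
  set τ := L (EuclideanSpace.single 0 1) 0 + L (EuclideanSpace.single 1 1) 1
  -- The linear part has flux sπτ through the circle of radius s; an error of τs/4 costs at most
  -- sπτ/2, leaving the flux positive.
  have hlin := hF.isLittleO.def (show 0 < τ / 4 by positivity)
  obtain ⟨r₁, hr₁, h₁⟩ := Metric.eventually_nhds_iff_ball.1 (hlin.and hmax)
  have hr : 0 < min r₁ ρ / 2 := by positivity
  obtain ⟨r, hr_def⟩ : ∃ r, r = min r₁ ρ / 2 := ⟨_, rfl⟩
  rw [← hr_def] at hr
  have hr1 : r < r₁ := by have := min_le_left r₁ ρ; linarith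
  have hr2 : r < ρ := by have := min_le_right r₁ ρ; linarith
  obtain ⟨J, hJc, hJ, hJint⟩ := integral_flux_eq hr hr2 hG hG'
  have hJpos : 0 < ∫ s in (0 : ℝ)..r, J s := by
    refine intervalIntegral.intervalIntegral_pos_of_pos_on (hJc.intervalIntegrable _ _) ?_ hr
    intro s hs
    have hsρ : s < ρ := hs.2.trans hr2
    rw [hJ s hs, hflux s ⟨hs.1, hsρ⟩]
    have hcirc := continuous_add_smul_circleDir x₀ s
    have hle : ∫ φ in (0 : ℝ)..2 * Real.pi,
        (inner ℝ (F x₀ + s • L (circleDir φ)) (circleDir φ) + -(τ / 4 * s)) ≤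
        ∫ φ in (0 : ℝ)..2 * Real.pi, inner ℝ (F (x₀ + s • circleDir φ)) (circleDir φ) := by
      refine intervalIntegral.integral_mono_on (by positivity) ?_ ?_ ?_
      · have := continuous_circleDir
        exact Continuous.intervalIntegrable (by fun_prop) _ _
      · exact ((hFc.comp_continuous hcirc fun φ =>
          add_smul_circleDir_mem_ball x₀ hs.1.le hsρ φ).inner
            continuous_circleDir).intervalIntegrable _ _
      · intro φ _
        have hb := (h₁ _ (add_smul_circleDir_mem_ball x₀ hs.1.le (hs.2.trans hr1) φ)).1
        rw [add_sub_cancel_left, norm_smul, norm_circleDir, mul_one, Real.norm_of_nonneg hs.1.le,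
          map_smul] at hb
        have hi := abs_le.1 (abs_real_inner_le_norm
          (F (x₀ + s • circleDir φ) - F x₀ - s • L (circleDir φ)) (circleDir φ))
        rw [norm_circleDir, mul_one, sub_sub, inner_sub_left] at hi
        rw [sub_sub] at hb
        linarith [hi.1]
    rw [integral_inner_affine_circleDir] at hle
    have hp := Real.pi_pos
    have : 0 < s * Real.pi * τ := mul_pos (mul_pos hs.1 hp) hpos
    linarith
  rw [hJint] at hJpos
  -- Positive fluxes would make the mean of `G` on the circle exceed its value at the local maximum.
  refine absurd hJpos (not_lt.2 ?_)
  have hnonneg : 0 ≤ ∫ φ in (0 : ℝ)..2 * Real.pi, -(G (x₀ + r • circleDir φ) - G x₀) :=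
    intervalIntegral.integral_nonneg Real.two_pi_pos.le fun φ _ => neg_nonneg.2
      (sub_nonpos.2 (h₁ _ (add_smul_circleDir_mem_ball x₀ hr.le hr1 φ)).2)
  rw [intervalIntegral.integral_neg] at hnonneg
  exact neg_nonneg.1 hnonneg

/-- The rotation of the plane by a quarter turn, clockwise. -/
noncomputable def quarterTurn : Plane →L[ℝ] Plane :=
  LinearMap.toContinuousLinearMap
    { toFun := fun v => !₂[v 1, -v 0]
      map_add' := fun v w => by ext i; fin_cases i <;> simp [add_comm]
      map_smul' := fun c v => by ext i; fin_cases i <;> simp }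

@[simp]
theorem quarterTurn_apply_zero (v : Plane) : quarterTurn v 0 = v 1 := rfl

@[simp]
theorem quarterTurn_apply_one (v : Plane) : quarterTurn v 1 = -v 0 := rfl

theorem plane_eq (v : Plane) :
    v = v 0 • EuclideanSpace.single 0 1 + v 1 • EuclideanSpace.single 1 1 := by
  ext i
  fin_cases i <;> simp

/-! ### Vorticity and momentum equations for a C² velocity in spacetime. -/

section Spacetime

variable {D : Set Plane} {v : ℝ → Plane → Plane}

/-- The material acceleration `∂v/∂t + (v · ∇) v`, as a directional derivative in spacetime. -/
noncomputable def acceleration (v : ℝ → Plane → Plane) (t : ℝ) (x : Plane) : Plane :=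
  fderiv ℝ (fun q : ℝ × Plane => v q.1 q.2) (t, x) (1, v t x)

variable (hD : IsOpen D)
  (hv : ContDiffOn ℝ 2 (fun q : ℝ × Plane => v q.1 q.2) (Set.univ ×ˢ D))

include hD hv

theorem contDiffAt_spacetime (t : ℝ) {x : Plane} (hx : x ∈ D) :
    ContDiffAt ℝ 2 (fun q : ℝ × Plane => v q.1 q.2) (t, x) :=
  hv.contDiffAt ((isOpen_univ.prod hD).mem_nhds ⟨trivial, hx⟩)

theorem hasFDerivAt_spacetime (t : ℝ) {x : Plane} (hx : x ∈ D) :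
    HasFDerivAt (fun q : ℝ × Plane => v q.1 q.2)
      (fderiv ℝ (fun q : ℝ × Plane => v q.1 q.2) (t, x)) (t, x) :=
  ((contDiffAt_spacetime hD hv t hx).differentiableAt two_ne_zero).hasFDerivAt

theorem hasFDerivAt_space (t : ℝ) {x : Plane} (hx : x ∈ D) :
    HasFDerivAt (v t) ((fderiv ℝ (fun q : ℝ × Plane => v q.1 q.2) (t, x)).comp
      (ContinuousLinearMap.inr ℝ ℝ Plane)) x :=
  (hasFDerivAt_spacetime hD hv t hx).comp x (hasFDerivAt_prodMk_right t x)

theorem hasFDerivAt_fderiv_spacetime (t : ℝ) {x : Plane} (hx : x ∈ D) :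
    HasFDerivAt (fderiv ℝ (fun q : ℝ × Plane => v q.1 q.2))
      (fderiv ℝ (fderiv ℝ (fun q : ℝ × Plane => v q.1 q.2)) (t, x)) (t, x) :=
  (((contDiffAt_spacetime hD hv t hx).fderiv_right (m := 1) le_rfl).differentiableAt
    one_ne_zero).hasFDerivAt

theorem partialDeriv_eq_spacetime (t : ℝ) {x : Plane} (hx : x ∈ D) (i j : Fin 2) :
    partialDeriv (v t) i j x =
      fderiv ℝ (fun q : ℝ × Plane => v q.1 q.2) (t, x) (0, EuclideanSpace.single i 1) j := by
  rw [partialDeriv, (hasFDerivAt_space hD hv t hx).fderiv]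
  rfl

theorem acceleration_eq (t : ℝ) {x : Plane} (hx : x ∈ D) :
    acceleration v t x = deriv (fun s => v s x) t + fderiv ℝ (v t) x (v t x) := by
  have h : HasDerivAt (fun s => v s x)
      (fderiv ℝ (fun q : ℝ × Plane => v q.1 q.2) (t, x) (1, 0)) t := by
    have h0 : HasDerivAt (fun s : ℝ => (s, x)) (1, 0) t :=
      (hasDerivAt_id' t).prodMk (hasDerivAt_const t x)
    exact (hasFDerivAt_spacetime hD hv t hx).comp_hasDerivAt t h0
  rw [h.deriv, (hasFDerivAt_space hD hv t hx).fderiv, acceleration,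
    ContinuousLinearMap.comp_apply, ← map_add]
  simp

theorem hasFDerivAt_partialDeriv_spacetime (t : ℝ) {x : Plane} (hx : x ∈ D) (i j : Fin 2) :
    HasFDerivAt (fun q : ℝ × Plane => partialDeriv (v q.1) i j q.2)
      ((EuclideanSpace.proj j : Plane →L[ℝ] ℝ).comp
        ((fderiv ℝ (fderiv ℝ (fun q : ℝ × Plane => v q.1 q.2)) (t, x)).flip
          (0, EuclideanSpace.single i 1))) (t, x) := by
  have h := (EuclideanSpace.proj j : Plane →L[ℝ] ℝ).hasFDerivAt.comp (t, x)
    ((hasFDerivAt_fderiv_spacetime hD hv t hx).clm_apply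
      (hasFDerivAt_const ((0, EuclideanSpace.single i 1) : ℝ × Plane) (t, x)))
  refine (h.congr_fderiv ?_).congr_of_eventuallyEq ?_
  · ext <;> simp
  · filter_upwards [(isOpen_univ.prod hD).mem_nhds
      (show ((t, x) : ℝ × Plane) ∈ Set.univ ×ˢ D from ⟨trivial, hx⟩)] with q hq
    exact partialDeriv_eq_spacetime hD hv q.1 hq.2 i j

theorem contDiffOn_vorticity_spacetime :
    ContDiffOn ℝ 1 (fun q : ℝ × Plane => vorticity (v q.1) q.2) (Set.univ ×ˢ D) := by
  have h : ContDiffOn ℝ 1 (fderiv ℝ (fun q : ℝ × Plane => v q.1 q.2)) (Set.univ ×ˢ D) :=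
    hv.fderiv_of_isOpen (isOpen_univ.prod hD) le_rfl
  have h' : ∀ i j : Fin 2, ContDiffOn ℝ 1 (fun q : ℝ × Plane =>
      fderiv ℝ (fun q : ℝ × Plane => v q.1 q.2) q (0, EuclideanSpace.single i 1) j)
      (Set.univ ×ˢ D) := fun i j =>
    (EuclideanSpace.proj j : Plane →L[ℝ] ℝ).contDiff.comp_contDiffOn
      (h.clm_apply contDiffOn_const)
  refine ((h' 0 1).sub (h' 1 0)).congr fun q hq => ?_
  rw [vorticity, partialDeriv_eq_spacetime hD hv q.1 hq.2,
    partialDeriv_eq_spacetime hD hv q.1 hq.2]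

theorem fderiv_vorticity_spacetime (t : ℝ) {x : Plane} (hx : x ∈ D) (ζ : ℝ × Plane) :
    fderiv ℝ (fun q : ℝ × Plane => vorticity (v q.1) q.2) (t, x) ζ =
      fderiv ℝ (fderiv ℝ (fun q : ℝ × Plane => v q.1 q.2)) (t, x) ζ
        (0, EuclideanSpace.single 0 1) 1 -
      fderiv ℝ (fderiv ℝ (fun q : ℝ × Plane => v q.1 q.2)) (t, x) ζ
        (0, EuclideanSpace.single 1 1) 0 := by
  have h := (hasFDerivAt_partialDeriv_spacetime hD hv t hx 0 1).sub
    (hasFDerivAt_partialDeriv_spacetime hD hv t hx 1 0)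
  have h' : fderiv ℝ (fun q : ℝ × Plane => vorticity (v q.1) q.2) (t, x) = _ := h.fderiv
  rw [h']
  simp

/-- The divergence vanishes on an open set of spacetime, so all its directional derivatives vanish
too; this is what turns Δv into the rotated gradient of the vorticity. -/
theorem fderiv_fderiv_divergence
    (hdiv : ∀ t, ∀ x ∈ D, planarDivergence (v t) x = 0) (t : ℝ) {x : Plane} (hx : x ∈ D)
    (ζ : ℝ × Plane) :
    fderiv ℝ (fderiv ℝ (fun q : ℝ × Plane => v q.1 q.2)) (t, x) ζ
        (0, EuclideanSpace.single 0 1) 0 +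
      fderiv ℝ (fderiv ℝ (fun q : ℝ × Plane => v q.1 q.2)) (t, x) ζ
        (0, EuclideanSpace.single 1 1) 1 = 0 := by
  have h := (hasFDerivAt_partialDeriv_spacetime hD hv t hx 0 0).add
    (hasFDerivAt_partialDeriv_spacetime hD hv t hx 1 1)
  have h0 := h.congr_of_eventuallyEq (f₁ := fun _ : ℝ × Plane => (0 : ℝ)) (by
    filter_upwards [(isOpen_univ.prod hD).mem_nhds
      (show ((t, x) : ℝ × Plane) ∈ Set.univ ×ˢ D from ⟨trivial, hx⟩)] with q hq
    exact (hdiv q.1 q.2 hq.2).symm)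
  simpa using congrArg (fun l : ℝ × Plane →L[ℝ] ℝ => l ζ) (h0.unique (hasFDerivAt_const _ _))

theorem laplacian_eq_spacetime (t : ℝ) {x : Plane} (hx : x ∈ D) :
    Laplacian.laplacian (v t) x =
      fderiv ℝ (fderiv ℝ (fun q : ℝ × Plane => v q.1 q.2)) (t, x)
        (0, EuclideanSpace.single 0 1) (0, EuclideanSpace.single 0 1) +
      fderiv ℝ (fderiv ℝ (fun q : ℝ × Plane => v q.1 q.2)) (t, x)
        (0, EuclideanSpace.single 1 1) (0, EuclideanSpace.single 1 1) := by
  have h : HasFDerivAt (fun y => (fderiv ℝ (fun q : ℝ × Plane => v q.1 q.2) (t, y)).comp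
      (ContinuousLinearMap.inr ℝ ℝ Plane)) _ x :=
    ((hasFDerivAt_fderiv_spacetime hD hv t hx).comp x (hasFDerivAt_prodMk_right t x)).clm_comp
      (hasFDerivAt_const (ContinuousLinearMap.inr ℝ ℝ Plane) x)
  have h' := h.congr_of_eventuallyEq (f₁ := fderiv ℝ (v t)) (by
    filter_upwards [hD.mem_nhds hx] with y hy
    exact (hasFDerivAt_space hD hv t hy).fderiv)
  rw [InnerProductSpace.laplacian_eq_iteratedFDeriv_orthonormalBasis _
    (EuclideanSpace.basisFun (Fin 2) ℝ)]
  simp [Fin.sum_univ_two, iteratedFDeriv_two_apply, h'.fderiv]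

theorem hasFDerivAt_acceleration (t : ℝ) {x : Plane} (hx : x ∈ D) :
    ∃ A : Plane →L[ℝ] Plane, HasFDerivAt (acceleration v t) A x ∧ ∀ η, A η =
      fderiv ℝ (fderiv ℝ (fun q : ℝ × Plane => v q.1 q.2)) (t, x) (0, η) (1, v t x) +
      fderiv ℝ (fun q : ℝ × Plane => v q.1 q.2) (t, x)
        (0, fderiv ℝ (fun q : ℝ × Plane => v q.1 q.2) (t, x) (0, η)) := by
  have h : HasFDerivAt (acceleration v t) _ x :=
    ((hasFDerivAt_fderiv_spacetime hD hv t hx).comp x (hasFDerivAt_prodMk_right t x)).clm_apply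
      ((hasFDerivAt_const (1 : ℝ) x).prodMk (hasFDerivAt_space hD hv t hx))
  refine ⟨_, h, fun η => ?_⟩
  simp [add_comm]

/-- The curl of the acceleration of an incompressible planar flow is the material derivative of the
vorticity. -/
theorem exists_hasFDerivAt_quarterTurn_acceleration
    (hdiv : ∀ t, ∀ x ∈ D, planarDivergence (v t) x = 0) (t : ℝ) {x : Plane} (hx : x ∈ D) :
    ∃ L : Plane →L[ℝ] Plane, HasFDerivAt (fun y => quarterTurn (acceleration v t y)) L x ∧
      L (EuclideanSpace.single 0 1) 0 + L (EuclideanSpace.single 1 1) 1 =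
        fderiv ℝ (fun q : ℝ × Plane => vorticity (v q.1) q.2) (t, x) (1, v t x) := by
  obtain ⟨A, hA, hA'⟩ := hasFDerivAt_acceleration hD hv t hx
  refine ⟨quarterTurn.comp A, quarterTurn.hasFDerivAt.comp x hA, ?_⟩
  rw [fderiv_vorticity_spacetime hD hv t hx]
  have hsymm : IsSymmSndFDerivAt ℝ (fun q : ℝ × Plane => v q.1 q.2) (t, x) :=
    (contDiffAt_spacetime hD hv t hx).isSymmSndFDerivAt (by simp)
  have hd := hdiv t x hx
  rw [planarDivergence, partialDeriv_eq_spacetime hD hv t hx,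
    partialDeriv_eq_spacetime hD hv t hx] at hd
  have hexp : ∀ w : Plane, fderiv ℝ (fun q : ℝ × Plane => v q.1 q.2) (t, x) (0, w) =
      w 0 • fderiv ℝ (fun q : ℝ × Plane => v q.1 q.2) (t, x) (0, EuclideanSpace.single 0 1) +
      w 1 • fderiv ℝ (fun q : ℝ × Plane => v q.1 q.2) (t, x) (0, EuclideanSpace.single 1 1) := by
    intro w
    rw [← map_smul, ← map_smul, ← map_add]
    congr 1
    ext1
    · simp
    · simpa using plane_eq w
  rw [hsymm.eq (1, v t x) (0, EuclideanSpace.single 0 1),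
    hsymm.eq (1, v t x) (0, EuclideanSpace.single 1 1)]
  simp only [ContinuousLinearMap.comp_apply, quarterTurn_apply_zero, quarterTurn_apply_one, hA']
  rw [hexp (fderiv ℝ _ (t, x) (0, EuclideanSpace.single 0 1)),
    hexp (fderiv ℝ _ (t, x) (0, EuclideanSpace.single 1 1))]
  simp only [PiLp.add_apply, PiLp.smul_apply, smul_eq_mul]
  -- The products of first derivatives in the curl of (v · ∇)v factor as vorticity times divergence;
  -- the coefficient here is the vorticity.
  linear_combination (fderiv ℝ (fun q : ℝ × Plane => v q.1 q.2) (t, x)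
    (0, EuclideanSpace.single 0 1) 1 - fderiv ℝ (fun q : ℝ × Plane => v q.1 q.2) (t, x)
    (0, EuclideanSpace.single 1 1) 0) * hd

theorem continuousOn_acceleration (t : ℝ) : ContinuousOn (acceleration v t) D := fun _ hx =>
  let ⟨_, hA, _⟩ := hasFDerivAt_acceleration hD hv t hx
  hA.continuousAt.continuousWithinAt

theorem contDiffOn_vorticity_space (t : ℝ) : ContDiffOn ℝ 1 (vorticity (v t)) D :=
  (contDiffOn_vorticity_spacetime hD hv).comp (contDiff_prodMk_right t).contDiffOn
    fun _ hx => ⟨trivial, hx⟩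

theorem fderiv_vorticity_space (t : ℝ) {x : Plane} (hx : x ∈ D) (η : Plane) :
    fderiv ℝ (vorticity (v t)) x η =
      fderiv ℝ (fun q : ℝ × Plane => vorticity (v q.1) q.2) (t, x) (0, η) := by
  have h : DifferentiableAt ℝ (fun q : ℝ × Plane => vorticity (v q.1) q.2) (t, x) :=
    ((contDiffOn_vorticity_spacetime hD hv).contDiffAt
      ((isOpen_univ.prod hD).mem_nhds ⟨trivial, hx⟩)).differentiableAt one_ne_zero
  rw [show fderiv ℝ (vorticity (v t)) x = _ from
    (h.hasFDerivAt.comp x (hasFDerivAt_prodMk_right t x)).fderiv]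
  rfl

/-- The vorticity form of the momentum equation: up to a tangential derivative of the pressure, the
radial derivative of the vorticity is given by the acceleration. -/
theorem fderiv_vorticity_circleDir {ν : ℝ} {p : Plane → ℝ}
    (hdiv : ∀ t, ∀ x ∈ D, planarDivergence (v t) x = 0) (t : ℝ) {x : Plane} (hx : x ∈ D)
    (hns : deriv (fun s => v s x) t + fderiv ℝ (v t) x (v t x) =
      -gradient p x + ν • Laplacian.laplacian (v t) x) (φ : ℝ) :
    ν * fderiv ℝ (vorticity (v t)) x (circleDir φ) -
      inner ℝ (quarterTurn (acceleration v t x)) (circleDir φ) =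
      fderiv ℝ p x !₂[-Real.sin φ, Real.cos φ] := by
  have hg : fderiv ℝ p x !₂[-Real.sin φ, Real.cos φ] =
      gradient p x 0 * -Real.sin φ + gradient p x 1 * Real.cos φ := by
    have h : fderiv ℝ p x !₂[-Real.sin φ, Real.cos φ] =
        inner ℝ (gradient p x) !₂[-Real.sin φ, Real.cos φ] := by simp [gradient]
    rw [h, PiLp.inner_apply, Fin.sum_univ_two]
    simp [mul_comm]
  rw [← acceleration_eq hD hv t hx, laplacian_eq_spacetime hD hv t hx] at hns
  have e0 := congrArg (fun w : Plane => w 0) hns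
  have e1 := congrArg (fun w : Plane => w 1) hns
  simp only [PiLp.add_apply, PiLp.smul_apply, PiLp.neg_apply, smul_eq_mul] at e0 e1
  have d0 := fderiv_fderiv_divergence hD hv hdiv t hx (0, EuclideanSpace.single 0 1)
  have d1 := fderiv_fderiv_divergence hD hv hdiv t hx (0, EuclideanSpace.single 1 1)
  have hsymm : IsSymmSndFDerivAt ℝ (fun q : ℝ × Plane => v q.1 q.2) (t, x) :=
    (contDiffAt_spacetime hD hv t hx).isSymmSndFDerivAt (by simp)
  have s01 := hsymm.eq (0, EuclideanSpace.single 0 1) (0, EuclideanSpace.single 1 1)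
  rw [hg, inner_circleDir, circleDir_eq, map_add, map_smul, map_smul,
    fderiv_vorticity_space hD hv t hx, fderiv_vorticity_space hD hv t hx,
    fderiv_vorticity_spacetime hD hv t hx, fderiv_vorticity_spacetime hD hv t hx]
  simp only [quarterTurn_apply_zero, quarterTurn_apply_one, smul_eq_mul, e0, e1]
  rw [s01] at d0 ⊢
  -- For div v = 0, Δv = (−∂₂ω, ∂₁ω).
  linear_combination (-ν * Real.cos φ) * d1 + (ν * Real.sin φ) * d0

/-- The flux of the vorticity gradient through a circle is determined by the acceleration. -/
theorem integral_fderiv_vorticity_circleDir {ν : ℝ} (hns : SolvesNavierStokes ν D v) (t : ℝ)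
    {x₀ : Plane} {ρ r : ℝ} (hball : Metric.ball x₀ ρ ⊆ D) (hr : r ∈ Set.Ioo 0 ρ) :
    ν * ∫ φ in (0 : ℝ)..2 * Real.pi,
        fderiv ℝ (vorticity (v t)) (x₀ + r • circleDir φ) (circleDir φ) =
      ∫ φ in (0 : ℝ)..2 * Real.pi,
        inner ℝ (quarterTurn (acceleration v t (x₀ + r • circleDir φ))) (circleDir φ) := by
  obtain ⟨hdiv, p, hp⟩ := hns
  have hmem : ∀ φ, x₀ + r • circleDir φ ∈ D := fun φ =>
    hball (add_smul_circleDir_mem_ball x₀ hr.1.le hr.2 φ)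
  have hcirc := continuous_add_smul_circleDir x₀ r
  have c1 : Continuous fun φ =>
      ν * fderiv ℝ (vorticity (v t)) (x₀ + r • circleDir φ) (circleDir φ) :=
    continuous_const.mul (((((contDiffOn_vorticity_space hD hv t).continuousOn_fderiv_of_isOpen hD
      le_rfl).comp_continuous hcirc hmem)).clm_apply continuous_circleDir)
  have c2 : Continuous fun φ =>
      inner ℝ (quarterTurn (acceleration v t (x₀ + r • circleDir φ))) (circleDir φ) :=
    (quarterTurn.continuous.comp
      ((continuousOn_acceleration hD hv t).comp_continuous hcirc hmem)).inner continuous_circleDir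
  rw [← intervalIntegral.integral_const_mul, ← sub_eq_zero,
    ← intervalIntegral.integral_sub (c1.intervalIntegrable _ _) (c2.intervalIntegrable _ _)]
  -- The difference of the integrands, times r, is the angular derivative of the pressure, which
  -- integrates to zero around the circle. Differentiability of the pressure suffices: the
  -- continuity needed for integration comes from `c1` and `c2`.
  have hd : ∀ φ ∈ Set.uIcc 0 (2 * Real.pi), HasDerivAt (fun φ => p t (x₀ + r • circleDir φ))
      (r * (ν * fderiv ℝ (vorticity (v t)) (x₀ + r • circleDir φ) (circleDir φ) -
        inner ℝ (quarterTurn (acceleration v t (x₀ + r • circleDir φ))) (circleDir φ))) φ := by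
    intro φ _
    obtain ⟨hpd, hpe⟩ := hp t _ (hmem φ)
    rw [fderiv_vorticity_circleDir hD hv hdiv t (hmem φ) hpe, ← smul_eq_mul, ← map_smul]
    have hcd : HasDerivAt circleDir !₂[-Real.sin φ, Real.cos φ] φ := by
      have h := ((Real.hasDerivAt_cos φ).smul_const (EuclideanSpace.single 0 1 : Plane)).add
        ((Real.hasDerivAt_sin φ).smul_const (EuclideanSpace.single 1 1 : Plane))
      refine (h.congr_deriv ?_).congr_of_eventuallyEq (.of_forall circleDir_eq)
      ext i
      fin_cases i <;> simp
    exact hpd.hasFDerivAt.comp_hasDerivAt φ ((hcd.const_smul r).const_add x₀)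
  have hint := intervalIntegral.integral_eq_sub_of_hasDerivAt hd
    ((continuous_const.mul (c1.sub c2)).intervalIntegrable _ _)
  rw [intervalIntegral.integral_const_mul] at hint
  have hper : circleDir (2 * Real.pi) = circleDir 0 := by simp [circleDir]
  rw [hper, sub_self] at hint
  exact (mul_eq_zero.1 hint).resolve_left hr.1.ne'

end Spacetime

/-! ### Maximum principle for viscous vorticity over all times. -/

section MaximumPrinciple

variable {D : Set Plane} {v : ℝ → Plane → Plane}

theorem hasFDerivAt_exp_coord (α : ℝ) (x : Plane) :
    HasFDerivAt (fun y : Plane => Real.exp (α * y 0))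
      (Real.exp (α * x 0) • α • (EuclideanSpace.proj 0 : Plane →L[ℝ] ℝ)) x :=
  (((EuclideanSpace.proj 0 : Plane →L[ℝ] ℝ).hasFDerivAt (x := x)).const_mul α).exp

/-- The parabolic second-order condition at a spatial maximum, for a vorticity which is only
continuously differentiable. -/
theorem materialDeriv_add_nonpos_of_isLocalMax (hD : IsOpen D)
    (hv : ContDiffOn ℝ 2 (fun q : ℝ × Plane => v q.1 q.2) (Set.univ ×ˢ D)) {ν : ℝ} (hν : 0 ≤ ν)
    (hns : SolvesNavierStokes ν D v) (t : ℝ) {x : Plane} (hx : x ∈ D) (σ δ α : ℝ)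
    (hmax : IsLocalMax (fun y => σ * vorticity (v t) y + δ * Real.exp (α * y 0)) x) :
    σ * fderiv ℝ (fun q : ℝ × Plane => vorticity (v q.1) q.2) (t, x) (1, v t x) +
      ν * (δ * (α ^ 2 * Real.exp (α * x 0))) ≤ 0 := by
  obtain ⟨ρ, hρ, hball⟩ := Metric.isOpen_iff.1 hD x hx
  obtain ⟨L, hL, hLtr⟩ := exists_hasFDerivAt_quarterTurn_acceleration hD hv hns.1 t hx
  have hω := contDiffOn_vorticity_space hD hv t
  let e₀ : Plane := EuclideanSpace.single 0 1
  -- `ψ` times the first basis vector is ν times the gradient of the exponential barrier, so it adds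
  -- exactly the missing flux.
  let ψ : Plane → ℝ := fun y => ν * (δ * (α * Real.exp (α * y 0)))
  have hψ : ∀ y, HasFDerivAt ψ (ν • δ • α • Real.exp (α * y 0) • α •
      (EuclideanSpace.proj 0 : Plane →L[ℝ] ℝ)) y := fun y =>
    (((hasFDerivAt_exp_coord α y).const_mul α).const_mul δ).const_mul ν
  have hG : ∀ y ∈ D, HasFDerivAt
      (fun y => ν * (σ * vorticity (v t) y + δ * Real.exp (α * y 0)))
      (ν • (σ • fderiv ℝ (vorticity (v t)) y + δ • Real.exp (α * y 0) • α •
        (EuclideanSpace.proj 0 : Plane →L[ℝ] ℝ))) y := fun y hy =>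
    ((((hω.contDiffAt (hD.mem_nhds hy)).differentiableAt one_ne_zero).hasFDerivAt.const_mul
      σ).add ((hasFDerivAt_exp_coord α y).const_mul δ)).const_mul ν
  have hωc := hω.continuousOn_fderiv_of_isOpen hD le_rfl
  have hGc : ContinuousOn (fderiv ℝ
      (fun y => ν * (σ * vorticity (v t) y + δ * Real.exp (α * y 0)))) D := by
    have : ContinuousOn (fun y => ν • (σ • fderiv ℝ (vorticity (v t)) y +
        δ • Real.exp (α * y 0) • α • (EuclideanSpace.proj 0 : Plane →L[ℝ] ℝ))) D := by
      fun_prop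
    exact this.congr fun y hy => (hG y hy).fderiv
  have hFd : HasFDerivAt (fun y => σ • quarterTurn (acceleration v t y) + ψ y • e₀) _ x :=
    (hL.const_smul σ).add ((hψ x).smul_const e₀)
  have hFc : ContinuousOn (fun y => σ • quarterTurn (acceleration v t y) + ψ y • e₀) D := by
    have h1 := continuousOn_acceleration hD hv t
    have h2 : Continuous ψ := by fun_prop
    have h3 : ContinuousOn (fun y => quarterTurn (acceleration v t y)) D :=
      quarterTurn.continuous.comp_continuousOn h1
    fun_prop
  have hcirc : ∀ r, Continuous fun φ => x + r • circleDir φ :=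
    continuous_add_smul_circleDir x
  have htr := trace_nonpos_of_isLocalMax hρ
    (fun y hy => (hG y (hball hy)).differentiableAt) (hGc.mono hball)
    (hmax.mono fun y hy => mul_le_mul_of_nonneg_left hy hν) hFd (hFc.mono hball) ?_
  · simp [e₀] at htr
    rw [← hLtr]
    linarith
  · intro r hr
    have hmem : ∀ φ, x + r • circleDir φ ∈ D := fun φ =>
      hball (add_smul_circleDir_mem_ball x hr.1.le hr.2 φ)
    have hflux := integral_fderiv_vorticity_circleDir hD hv hns t hball hr
    have c1 : Continuous fun φ => fderiv ℝ (vorticity (v t)) (x + r • circleDir φ) (circleDir φ) :=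
      (hωc.comp_continuous (hcirc r) hmem).clm_apply continuous_circleDir
    have c2 : Continuous fun φ =>
        inner ℝ (quarterTurn (acceleration v t (x + r • circleDir φ))) (circleDir φ) :=
      (quarterTurn.continuous.comp ((continuousOn_acceleration hD hv t).comp_continuous
        (hcirc r) hmem)).inner continuous_circleDir
    have c3 : Continuous fun φ => ψ (x + r • circleDir φ) * Real.cos φ := by
      have := hcirc r
      fun_prop
    calc ∫ φ in (0 : ℝ)..2 * Real.pi, fderiv ℝ
          (fun y => ν * (σ * vorticity (v t) y + δ * Real.exp (α * y 0)))
          (x + r • circleDir φ) (circleDir φ)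
        = ∫ φ in (0 : ℝ)..2 * Real.pi,
          (σ * (ν * fderiv ℝ (vorticity (v t)) (x + r • circleDir φ) (circleDir φ)) +
            ψ (x + r • circleDir φ) * Real.cos φ) := by
          refine intervalIntegral.integral_congr fun φ _ => ?_
          simp only [(hG _ (hmem φ)).fderiv]
          simp [ψ, circleDir]
          ring
      _ = σ * (ν * ∫ φ in (0 : ℝ)..2 * Real.pi,
            fderiv ℝ (vorticity (v t)) (x + r • circleDir φ) (circleDir φ)) +
            ∫ φ in (0 : ℝ)..2 * Real.pi, ψ (x + r • circleDir φ) * Real.cos φ := by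
          rw [intervalIntegral.integral_add (Continuous.intervalIntegrable (by fun_prop) _ _)
            (c3.intervalIntegrable _ _), intervalIntegral.integral_const_mul,
            intervalIntegral.integral_const_mul]
      _ = ∫ φ in (0 : ℝ)..2 * Real.pi,
          (σ * inner ℝ (quarterTurn (acceleration v t (x + r • circleDir φ))) (circleDir φ) +
            ψ (x + r • circleDir φ) * Real.cos φ) := by
          rw [hflux, intervalIntegral.integral_add
            (Continuous.intervalIntegrable (by fun_prop) _ _)
            (c3.intervalIntegrable _ _), intervalIntegral.integral_const_mul]
      _ = _ := by
          refine intervalIntegral.integral_congr fun φ _ => ?_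
          simp [inner_add_left, real_inner_smul_left, inner_circleDir, e₀]

theorem hasDerivAt_sqrt_one_add_sq (t : ℝ) :
    HasDerivAt (fun s : ℝ => √(1 + s ^ 2)) (t / √(1 + t ^ 2)) t := by
  have h := (((hasDerivAt_id' t).fun_pow 2).const_add 1).sqrt (by positivity)
  refine h.congr_deriv ?_
  have : √(1 + t ^ 2) ≠ 0 := by positivity
  field_simp
  norm_num

theorem abs_le_sqrt_one_add_sq (t : ℝ) : |t| ≤ √(1 + t ^ 2) :=
  Real.abs_le_sqrt (by linarith)

/-- The vorticity plus a strict subsolution cannot have an interior maximum in spacetime. -/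
theorem not_isLocalMax_vorticity_add_barrier (hD : IsOpen D)
    (hv : ContDiffOn ℝ 2 (fun q : ℝ × Plane => v q.1 q.2) (Set.univ ×ˢ D)) {ν : ℝ} (hν : 0 ≤ ν)
    (hns : SolvesNavierStokes ν D v) (t : ℝ) {x : Plane} (hx : x ∈ D) {σ δ α κ : ℝ} (hδ : 0 < δ)
    (hα : 0 < α) (hκ : 0 ≤ κ) (hνα : v t x 0 + 1 ≤ ν * α) (hκα : κ < α * Real.exp (α * x 0)) :
    ¬ IsLocalMax (fun q : ℝ × Plane => σ * vorticity (v q.1) q.2 + δ * Real.exp (α * q.2 0)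
      - δ * κ * √(1 + q.1 ^ 2)) (t, x) := by
  intro hloc
  have hW : HasFDerivAt (fun q : ℝ × Plane => vorticity (v q.1) q.2)
      (fderiv ℝ (fun q : ℝ × Plane => vorticity (v q.1) q.2) (t, x)) (t, x) :=
    (((contDiffOn_vorticity_spacetime hD hv).contDiffAt
      ((isOpen_univ.prod hD).mem_nhds ⟨trivial, hx⟩)).differentiableAt one_ne_zero).hasFDerivAt
  have hE : HasFDerivAt (fun q : ℝ × Plane => Real.exp (α * q.2 0))
      ((Real.exp (α * x 0) • α • (EuclideanSpace.proj 0 : Plane →L[ℝ] ℝ)).comp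
        (ContinuousLinearMap.snd ℝ ℝ Plane)) (t, x) :=
    HasFDerivAt.comp (g := fun y : Plane => Real.exp (α * y 0)) (f := Prod.snd) (t, x)
      (hasFDerivAt_exp_coord α x) hasFDerivAt_snd
  have hQ : HasFDerivAt (fun q : ℝ × Plane => √(1 + q.1 ^ 2))
      ((ContinuousLinearMap.toSpanSingleton ℝ (t / √(1 + t ^ 2))).comp
        (ContinuousLinearMap.fst ℝ ℝ Plane)) (t, x) :=
    HasFDerivAt.comp (g := fun s : ℝ => √(1 + s ^ 2)) (f := Prod.fst) (t, x)
      (hasDerivAt_sqrt_one_add_sq t).hasFDerivAt hasFDerivAt_fst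
  have hzero := hloc.hasFDerivAt_eq_zero
    (((hW.const_mul σ).add (hE.const_mul δ)).sub (hQ.const_mul (δ * κ)))
  -- Evaluating the vanishing differential along (1, v) brings out the material derivative, to be
  -- compared with the spatial second-order condition `hle`.
  have hzero' : σ * fderiv ℝ (fun q : ℝ × Plane => vorticity (v q.1) q.2) (t, x) (1, v t x) +
      δ * (Real.exp (α * x 0) * (α * v t x 0)) - δ * κ * (1 * (t / √(1 + t ^ 2))) = 0 :=
    congrArg (fun l : ℝ × Plane →L[ℝ] ℝ => l (1, v t x)) hzero
  have hsp : IsLocalMax (fun y => σ * vorticity (v t) y + δ * Real.exp (α * y 0)) x := by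
    have hc : Tendsto (fun y : Plane => (t, y)) (𝓝 x) (𝓝 (t, x)) :=
      (Continuous.prodMk_right t).tendsto x
    filter_upwards [hc.eventually hloc] with y hy
    exact (sub_le_sub_iff_right _).1 hy
  have hle := materialDeriv_add_nonpos_of_isLocalMax hD hv hν hns t hx σ δ α hsp
  have hs : -1 ≤ t / √(1 + t ^ 2) := by
    rw [le_div_iff₀ (by positivity)]
    have := neg_abs_le t
    have := abs_le_sqrt_one_add_sq t
    linarith
  have h1 : δ * (α * Real.exp (α * x 0)) * 1 ≤
      δ * (α * Real.exp (α * x 0)) * (ν * α - v t x 0) :=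
    mul_le_mul_of_nonneg_left (by linarith) (by positivity)
  have h2 := mul_le_mul_of_nonneg_left hs (mul_nonneg hδ.le hκ)
  have h3 := mul_lt_mul_of_pos_left hκα hδ
  linarith

/-- **Maximum principle** for the vorticity of an eternal viscous flow: the bound `M` propagates
from the lateral boundary `S \ U` to all of `S`. -/
theorem vorticity_le_of_boundary_le (hD : IsOpen D)
    (hv : ContDiffOn ℝ 2 (fun q : ℝ × Plane => v q.1 q.2) (Set.univ ×ˢ D)) {ν : ℝ} (hν : 0 < ν)
    (hns : SolvesNavierStokes ν D v) {S U : Set (ℝ × Plane)} (hS : IsClosed S) (hU : IsOpen U)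
    (hUS : U ⊆ S) (hSD : ∀ q ∈ S, q.2 ∈ D) {R B C M σ : ℝ} (hR : ∀ x ∈ D, ‖x‖ ≤ R)
    (hB : ∀ q ∈ S, ‖v q.1 q.2‖ ≤ B) (hC : ∀ q ∈ S, σ * vorticity (v q.1) q.2 ≤ C)
    (hM : ∀ q ∈ S, q ∉ U → σ * vorticity (v q.1) q.2 ≤ M) :
    ∀ q ∈ S, σ * vorticity (v q.1) q.2 ≤ M := by
  intro q₁ hq₁
  have hB0 : 0 ≤ B := (norm_nonneg _).trans (hB q₁ hq₁)
  -- With να = B + 1, diffusion of exp(αx₁) beats advection at any speed up to `B`.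
  obtain ⟨α, hα⟩ : ∃ α, α = (B + 1) / ν := ⟨_, rfl⟩
  have hα0 : 0 < α := by rw [hα]; positivity
  have hνα : ν * α = B + 1 := by rw [hα]; field_simp
  -- Half the least possible value of α exp(αx₁) on `D`, so the time penalty is strictly dominated.
  obtain ⟨κ, hκ⟩ : ∃ κ, κ = α * Real.exp (-(α * R)) / 2 := ⟨_, rfl⟩
  have hκ0 : 0 < κ := by rw [hκ]; positivity
  have hcoord : ∀ x ∈ D, -R ≤ x 0 ∧ x 0 ≤ R := fun x hx =>
    abs_le.1 ((PiLp.norm_apply_le x 0).trans (hR x hx))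
  have hexp_le : ∀ x ∈ D, Real.exp (α * x 0) ≤ Real.exp (α * R) := fun x hx =>
    Real.exp_le_exp.2 (mul_le_mul_of_nonneg_left (hcoord x hx).2 hα0.le)
  have hle_exp : ∀ x ∈ D, Real.exp (-(α * R)) ≤ Real.exp (α * x 0) := fun x hx =>
    Real.exp_le_exp.2 (by
      have := mul_le_mul_of_nonneg_left (hcoord x hx).1 hα0.le
      linarith)
  have main : ∀ δ, 0 < δ → σ * vorticity (v q₁.1) q₁.2 ≤
      M + δ * (Real.exp (α * R) + κ * √(1 + q₁.1 ^ 2)) := by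
    intro δ hδ
    let h : ℝ × Plane → ℝ := fun q => σ * vorticity (v q.1) q.2 + δ * Real.exp (α * q.2 0)
      - δ * κ * √(1 + q.1 ^ 2)
    have hωc := contDiffOn_vorticity_spacetime hD hv
    have hSsub : S ⊆ Set.univ ×ˢ D := fun q hq => ⟨trivial, hSD q hq⟩
    have hcont : ContinuousOn h S := by
      have h1 := hωc.continuousOn.mono hSsub
      have h2 : Continuous fun q : ℝ × Plane => Real.exp (α * q.2 0) := by fun_prop
      have h3 : Continuous fun q : ℝ × Plane => √(1 + q.1 ^ 2) := by fun_prop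
      exact ((continuousOn_const.mul h1).add (continuous_const.mul h2).continuousOn).sub
        (continuous_const.mul h3).continuousOn
    -- Space is bounded and the penalty δκ√(1 + t²) outgrows the bounded vorticity, so outside a
    -- compact set `h` is at most `h q₁`.
    obtain ⟨q₀, hq₀, hq₀max⟩ := hcont.exists_isMaxOn' hS hq₁ (by
      have hK : IsCompact (Set.Icc (-((C + δ * Real.exp (α * R) - h q₁) / (δ * κ)))
          ((C + δ * Real.exp (α * R) - h q₁) / (δ * κ)) ×ˢ Metric.closedBall (0 : Plane) R) :=
        isCompact_Icc.prod (isCompact_closedBall _ _)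
      rw [eventually_inf_principal]
      filter_upwards [hK.compl_mem_cocompact] with q hq hqS
      have hqt : (C + δ * Real.exp (α * R) - h q₁) / (δ * κ) ≤ |q.1| := by
        by_contra! hlt
        exact hq ⟨abs_le.1 hlt.le, by simpa using hR _ (hSD q hqS)⟩
      rw [div_le_iff₀ (by positivity)] at hqt
      have e1 := hC q hqS
      have e2 := mul_le_mul_of_nonneg_left (hexp_le _ (hSD q hqS)) hδ.le
      have e3 := mul_le_mul_of_nonneg_left (abs_le_sqrt_one_add_sq q.1) (mul_pos hδ hκ0).le
      have e4 : h q = σ * vorticity (v q.1) q.2 + δ * Real.exp (α * q.2 0)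
        - δ * κ * √(1 + q.1 ^ 2) := rfl
      linarith)
    have hmax1 : h q₁ ≤ h q₀ := hq₀max hq₁
    have hq₁e : h q₁ = σ * vorticity (v q₁.1) q₁.2 + δ * Real.exp (α * q₁.2 0)
        - δ * κ * √(1 + q₁.1 ^ 2) := rfl
    have hq₀e : h q₀ = σ * vorticity (v q₀.1) q₀.2 + δ * Real.exp (α * q₀.2 0)
        - δ * κ * √(1 + q₀.1 ^ 2) := rfl
    have hx₀ := hSD q₀ hq₀
    by_cases hq₀U : q₀ ∈ U
    · exfalso
      refine not_isLocalMax_vorticity_add_barrier hD hv hν.le hns q₀.1 hx₀ (σ := σ) hδ hα0 hκ0.le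
        ?_ ?_ (Filter.mem_of_superset (hU.mem_nhds hq₀U) fun q hq => hq₀max (hUS hq))
      · rw [hνα]
        have := (le_abs_self _).trans ((PiLp.norm_apply_le (v q₀.1 q₀.2) 0).trans (hB _ hq₀))
        linarith
      · have e1 := mul_le_mul_of_nonneg_left (hle_exp _ hx₀) hα0.le
        have e2 : 0 < α * Real.exp (-(α * R)) := by positivity
        linarith
    · have e1 := hM q₀ hq₀ hq₀U
      have e2 := mul_le_mul_of_nonneg_left (hexp_le _ hx₀) hδ.le
      have e3 : 0 ≤ δ * κ * √(1 + q₀.1 ^ 2) := by positivity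
      have e4 : 0 ≤ δ * Real.exp (α * q₁.2 0) := by positivity
      linarith
  -- The barrier is removed by letting δ → 0 at the fixed point `q₁`.
  refine le_of_forall_pos_le_add fun ε hε => ?_
  have hK : 0 < Real.exp (α * R) + κ * √(1 + q₁.1 ^ 2) := by positivity
  have := main (ε / (Real.exp (α * R) + κ * √(1 + q₁.1 ^ 2))) (by positivity)
  rwa [div_mul_cancel₀ _ hK.ne'] at this

end MaximumPrinciple

end PlanarCalculus

/-! ### Periodic profiles and the regular limit. -/

section QuasiPeriodic

variable {m : ℕ} {D : Set Plane}

/-- A function which is `2π`-periodic in each phase depends only on the phases modulo `2π`. -/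
theorem eq_of_phase_eq {E : Type*} {f : (Fin m → ℝ) → E}
    (hf : ∀ θ i, f (θ + Pi.single i (2 * Real.pi)) = f θ) {θ θ' : Fin m → ℝ}
    (h : phase θ = phase θ') : f θ = f θ' := by
  -- The periods of `f` form a group; phase vectors equal modulo 2π differ by an integer combination
  -- of its basic elements.
  let P : AddSubgroup (Fin m → ℝ) :=
    { carrier := {τ | ∀ θ, f (θ + τ) = f θ}
      zero_mem' := fun θ => by rw [add_zero]
      add_mem' := fun {a b} ha hb θ => by rw [← add_assoc, hb, ha]
      neg_mem' := fun {a} ha θ => by rw [← ha (θ + -a), neg_add_cancel_right] }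
  have hdiff : θ - θ' ∈ P := by
    rw [← Finset.univ_sum_single (θ - θ')]
    refine P.sum_mem fun i _ => ?_
    obtain ⟨k, hk⟩ := (QuotientAddGroup.eq_iff_sub_mem.1 (congrFun h i))
    have : (Pi.single i ((θ - θ') i) : Fin m → ℝ) = k • Pi.single i (2 * Real.pi) := by
      rw [← Pi.single_smul]
      exact congrArg _ hk.symm
    rw [this]
    exact P.zsmul_mem (fun θ => hf θ i) k
  simpa using hdiff θ'

/-- By periodicity it suffices to bound `f` over one box of phases. The part of `R` over that box is
compact, although `D` need not be closed, because `R` is closed and lies over the bounded set `D`.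
-/
theorem exists_norm_le_of_periodic {E : Type*} [SeminormedAddCommGroup E]
    (hD : Bornology.IsBounded D) {f : (Fin m → ℝ) → Plane → E}
    (hf : ContinuousOn (fun q : (Fin m → ℝ) × Plane => f q.1 q.2) (Set.univ ×ˢ D))
    (hper : ∀ θ i, ∀ x ∈ D, f (θ + Pi.single i (2 * Real.pi)) x = f θ x)
    {R : Set (ExtendedSpace m)} (hR : IsClosed R) (hRD : ∀ q ∈ R, q.1 ∈ D) :
    ∃ C, ∀ θ x, (x, phase θ) ∈ R → ‖f θ x‖ ≤ C := by
  let K : Set ((Fin m → ℝ) × Plane) :=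
    (Set.Icc 0 (fun _ => 2 * Real.pi) ×ˢ closure D) ∩ {q | (q.2, phase q.1) ∈ R}
  have hK : IsCompact K := (isCompact_Icc.prod hD.isCompact_closure).inter_right
    (hR.preimage (continuous_snd.prodMk ((continuous_phase m).comp continuous_fst)))
  obtain ⟨C, hC⟩ := hK.exists_bound_of_continuousOn
    (hf.mono fun q hq => ⟨trivial, hRD _ hq.2⟩)
  refine ⟨C, fun θ x hx => ?_⟩
  let θ' : Fin m → ℝ := fun i => toIcoMod Real.two_pi_pos 0 (θ i)
  have hθ : phase θ' = phase θ := funext fun i => by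
    refine QuotientAddGroup.eq_iff_sub_mem.2 ⟨-toIcoDiv Real.two_pi_pos 0 (θ i), ?_⟩
    change -toIcoDiv Real.two_pi_pos 0 (θ i) • (2 * Real.pi) =
      toIcoMod Real.two_pi_pos 0 (θ i) - θ i
    rw [toIcoMod_sub_self]
  have hxD := hRD _ hx
  rw [← eq_of_phase_eq (f := fun θ => f θ x) (fun θ i => hper θ i x hxD) hθ]
  refine hC (θ', x) ⟨⟨⟨fun i => ?_, fun i => ?_⟩, subset_closure hxD⟩, ?_⟩
  · exact left_le_toIcoMod Real.two_pi_pos 0 (θ i)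
  · have := toIcoMod_lt_right Real.two_pi_pos 0 (θ i)
    rw [zero_add] at this
    exact this.le
  · change (x, phase θ') ∈ R
    rwa [hθ]

theorem continuousOn_vorticity_profile (hD : IsOpen D) {u : (Fin m → ℝ) → Plane → Plane}
    (hu : ContDiffOn ℝ 2 (fun q : (Fin m → ℝ) × Plane => u q.1 q.2) (Set.univ ×ˢ D)) :
    ContinuousOn (fun q : (Fin m → ℝ) × Plane => vorticity (u q.1) q.2) (Set.univ ×ˢ D) := by
  have hopen : IsOpen ((Set.univ : Set (Fin m → ℝ)) ×ˢ D) := isOpen_univ.prod hD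
  have h := hu.continuousOn_fderiv_of_isOpen hopen one_le_two
  have hp : ∀ i j : Fin 2, ContinuousOn
      (fun q : (Fin m → ℝ) × Plane => partialDeriv (u q.1) i j q.2) (Set.univ ×ˢ D) := by
    intro i j
    have h' : ContinuousOn (fun q => fderiv ℝ (fun q : (Fin m → ℝ) × Plane => u q.1 q.2) q
        (0, EuclideanSpace.single i 1) j) (Set.univ ×ˢ D) :=
      (EuclideanSpace.proj j : Plane →L[ℝ] ℝ).continuous.comp_continuousOn
        (h.clm_apply continuousOn_const)
    refine h'.congr fun q hq => ?_
    obtain ⟨θ, x⟩ := q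
    have hd : HasFDerivAt (u θ) _ x :=
      ((hu.contDiffAt (hopen.mem_nhds hq)).differentiableAt two_ne_zero).hasFDerivAt.comp x
        (hasFDerivAt_prodMk_right θ x)
    change partialDeriv (u θ) i j x = _
    rw [partialDeriv, hd.fderiv]
    rfl
  exact (hp 0 1).sub (hp 1 0)

theorem vorticity_congr (hD : IsOpen D) {v w : Plane → Plane} (h : ∀ x ∈ D, v x = w x) {x : Plane}
    (hx : x ∈ D) : vorticity v x = vorticity w x := by
  have : v =ᶠ[𝓝 x] w := Filter.mem_of_superset (hD.mem_nhds hx) h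
  simp only [vorticity, partialDeriv, this.fderiv_eq]

theorem IsQuasiPeriodicFlow.contDiffOn_spacetime {ν : ℝ} {Ω : Fin m → ℝ}
    {u : (Fin m → ℝ) → Plane → Plane} (hu : IsQuasiPeriodicFlow ν D Ω u) :
    ContDiffOn ℝ 2 (fun q : ℝ × Plane => u (q.1 • Ω) q.2) (Set.univ ×ˢ D) :=
  hu.contDiffOn.comp (t := Set.univ ×ˢ D) (f := fun q : ℝ × Plane => (q.1 • Ω, q.2))
    ((contDiff_fst.smul contDiff_const).prodMk contDiff_snd).contDiffOn
    fun _ hq => ⟨trivial, hq.2⟩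

/-- In the regular limit the vorticity in the volume enclosed by a set on which the vorticity is
constant tends to the same constant. -/
theorem eventually_abs_vorticity_sub_le (hD_open : IsOpen D) (hD_bounded : Bornology.IsBounded D)
    {Ω : Fin m → ℝ} {u : (Fin m → ℝ) → Plane → Plane} (hu : IsQuasiPeriodicFlow 0 D Ω u)
    {T : Set (ExtendedSpace m)} (hT : IsClosed T) (hTD : ∀ q ∈ filledRegion T, q.1 ∈ D) {c : ℝ}
    (hc : ∀ (θ : Fin m → ℝ) (x : Plane), (x, phase θ) ∈ T → vorticity (u θ) x = c)
    {ν : ℕ → ℝ} (hν_pos : ∀ k, 0 < ν k)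
    {n : ℕ → ℕ} {Λ : ∀ k, Fin (n k) → ℝ} {w : ∀ k, (Fin (n k) → ℝ) → Plane → Plane}
    (hw : ∀ k, IsQuasiPeriodicFlow (ν k) D (Λ k) (w k)) {Θ : ℕ → Fin m → ℝ}
    (hlim : IsRegularLimitOn u Θ (fun k t => w k (t • Λ k)) (filledRegion T)) {ε : ℝ}
    (hε : 0 < ε) :
    ∀ᶠ k in atTop, ∀ (t : ℝ) (x : Plane), (x, phase (t • Θ k)) ∈ filledRegion T →
      |vorticity (u (t • Θ k)) x - c| ≤ 2 * ε := by
  obtain ⟨R, hR⟩ := hD_bounded.exists_norm_le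
  have hcl := isClosed_filledRegion hT
  obtain ⟨B, hB⟩ := exists_norm_le_of_periodic hD_bounded hu.contDiffOn.continuousOn hu.periodic
    hcl hTD
  obtain ⟨C, hC⟩ := exists_norm_le_of_periodic hD_bounded (f := fun θ => vorticity (u θ))
    (continuousOn_vorticity_profile hD_open hu.contDiffOn)
    (fun θ i x hx => vorticity_congr hD_open (fun y hy => hu.periodic θ i y hy) hx) hcl hTD
  filter_upwards [hlim ε hε] with k hk
  have hcont : Continuous fun q : ℝ × Plane => ((q.2, phase (q.1 • Θ k)) : ExtendedSpace m) := by
    have := continuous_phase m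
    exact continuous_snd.prodMk (this.comp (continuous_fst.smul continuous_const))
  -- The signs σ = ±1 give the upper and lower bounds. A point of the tube outside the preimage of
  -- the enclosed region lies over `T`, where the inviscid vorticity is c.
  have hmax : ∀ σ : ℝ, |σ| = 1 → ∀ q : ℝ × Plane, (q.2, phase (q.1 • Θ k)) ∈ filledRegion T →
      σ * vorticity (w k (q.1 • Λ k)) q.2 ≤ σ * c + ε := by
    intro σ hσ
    have hclose : ∀ q : ℝ × Plane, (q.2, phase (q.1 • Θ k)) ∈ filledRegion T →
        σ * vorticity (w k (q.1 • Λ k)) q.2 ≤ σ * vorticity (u (q.1 • Θ k)) q.2 + ε := by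
      intro q hq
      have := (le_abs_self _).trans_eq
        (abs_mul σ (vorticity (w k (q.1 • Λ k)) q.2 - vorticity (u (q.1 • Θ k)) q.2))
      rw [hσ, one_mul] at this
      linarith [(hk q.1 q.2 hq).2]
    refine vorticity_le_of_boundary_le hD_open (hw k).contDiffOn_spacetime (hν_pos k) (hw k).solves
      (S := (fun q : ℝ × Plane => ((q.2, phase (q.1 • Θ k)) : ExtendedSpace m)) ⁻¹' filledRegion T)
      (U := (fun q : ℝ × Plane => ((q.2, phase (q.1 • Θ k)) : ExtendedSpace m)) ⁻¹'
        enclosedRegion T)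
      (hcl.preimage hcont) ((isOpen_enclosedRegion hT).preimage hcont)
      (Set.preimage_mono Set.subset_union_right) (fun q hq => hTD _ hq) (R := R) (B := B + ε)
      (C := C + ε) hR ?_ ?_ ?_
    · intro q hq
      have h1 := norm_le_norm_add_norm_sub' (w k (q.1 • Λ k) q.2) (u (q.1 • Θ k) q.2)
      linarith [(hk q.1 q.2 hq).1, hB _ _ hq]
    · intro q hq
      have h1 := (le_abs_self _).trans_eq (abs_mul σ (vorticity (u (q.1 • Θ k)) q.2))
      rw [hσ, one_mul] at h1
      have h2 := hC _ _ hq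
      rw [Real.norm_eq_abs] at h2
      linarith [hclose q hq]
    · intro q hq hqU
      rw [← hc _ _ (hq.resolve_right hqU)]
      exact hclose q hq
  intro t x hx
  have h1 := hmax 1 (by simp) (t, x) hx
  have h2 := hmax (-1) (by simp) (t, x) hx
  have h3 := abs_lt.1 (hk t x hx).2
  rw [abs_le]
  constructor <;> linarith

/-- In the regular limit the vorticity is constant in the volume enclosed by a set on which it is
constant. -/
theorem vorticity_eq_on_filledRegion (hD_open : IsOpen D) (hD_bounded : Bornology.IsBounded D)
    {Ω : Fin m → ℝ} {u : (Fin m → ℝ) → Plane → Plane} (hu : IsQuasiPeriodicFlow 0 D Ω u)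
    {T : Set (ExtendedSpace m)} (hT : IsClosed T) (hTD : ∀ q ∈ filledRegion T, q.1 ∈ D) {c : ℝ}
    (hc : ∀ (θ : Fin m → ℝ) (x : Plane), (x, phase θ) ∈ T → vorticity (u θ) x = c)
    {ν : ℕ → ℝ} (hν_pos : ∀ k, 0 < ν k)
    {n : ℕ → ℕ} {Λ : ∀ k, Fin (n k) → ℝ} {w : ∀ k, (Fin (n k) → ℝ) → Plane → Plane}
    (hw : ∀ k, IsQuasiPeriodicFlow (ν k) D (Λ k) (w k)) {Θ : ℕ → Fin m → ℝ}
    (hΘ : Tendsto Θ atTop (𝓝 Ω))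
    (hlim : IsRegularLimitOn u Θ (fun k t => w k (t • Λ k)) (filledRegion T)) (θ : Fin m → ℝ)
    (x : Plane) (hx : (x, phase θ) ∈ filledRegion T) : vorticity (u θ) x = c := by
  rcases hx with hx | hx
  · exact hc θ x hx
  have hxD : x ∈ D := hTD _ (Or.inr hx)
  have hωc : Continuous fun θ => vorticity (u θ) x :=
    (continuousOn_vorticity_profile hD_open hu.contDiffOn).comp_continuous
      (Continuous.prodMk_left x) fun _ => ⟨trivial, hxD⟩
  have hUo : IsOpen {η : StdTorus m | (x, η) ∈ enclosedRegion T} :=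
    (isOpen_enclosedRegion hT).preimage (Continuous.prodMk_right x)
  -- With t and x fixed, openness of the enclosed region keeps (x, tΘ_k) inside it for large k, so
  -- drifting frequencies do no harm although tΘ_k − tΩ need not be small uniformly in t.
  have horbit : ∀ t : ℝ, (x, phase (t • Ω)) ∈ enclosedRegion T → vorticity (u (t • Ω)) x = c := by
    intro t ht
    have htend : Tendsto (fun k => t • Θ k) atTop (𝓝 (t • Ω)) := hΘ.const_smul t
    have hmem : ∀ᶠ k in atTop, (x, phase (t • Θ k)) ∈ enclosedRegion T :=
      (((continuous_phase m).tendsto _).comp htend).eventually (hUo.mem_nhds ht)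
    rw [← sub_eq_zero, ← abs_nonpos_iff]
    refine le_of_forall_pos_le_add fun ε hε => ?_
    rw [zero_add]
    have hlimω : Tendsto (fun k => |vorticity (u (t • Θ k)) x - c|) atTop
        (𝓝 |vorticity (u (t • Ω)) x - c|) :=
      ((((hωc.tendsto _).comp htend).sub_const c).abs)
    refine le_of_tendsto hlimω ?_
    filter_upwards [hmem, eventually_abs_vorticity_sub_le hD_open hD_bounded hu hT hTD hc hν_pos hw
      hlim (half_pos hε)] with k hk1 hk2
    linarith [hk2 t x (Or.inr hk1)]
  have hdense : Dense ((phase : (Fin m → ℝ) → StdTorus m) ⁻¹'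
      Set.range fun t : ℝ => phase (t • Ω)) :=
    (isOpenQuotientMap_phase m).dense_preimage_iff.2
      (denseRange_phase_line hu.rationally_independent)
  -- At fixed x the admissible phases form an open set, in which those on the orbit are dense.
  have hmem : θ ∈ closure (phase ⁻¹' {η : StdTorus m | (x, η) ∈ enclosedRegion T} ∩
      (phase : (Fin m → ℝ) → StdTorus m) ⁻¹' Set.range fun t : ℝ => phase (t • Ω)) :=
    hdense.open_subset_closure_inter (hUo.preimage (continuous_phase m)) hx
  refine closure_minimal (t := {θ | vorticity (u θ) x = c}) ?_
    (isClosed_eq hωc continuous_const) hmem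
  rintro η ⟨hη, t, ht⟩
  have hper : vorticity (u η) x = vorticity (u (t • Ω)) x :=
    eq_of_phase_eq (f := fun θ => vorticity (u θ) x)
      (fun θ i => vorticity_congr hD_open (fun y hy => hu.periodic θ i y hy) hxD) ht.symm
  have hη' : (x, phase η) ∈ enclosedRegion T := hη
  rw [← ht] at hη'
  exact hper.trans (horbit t hη')

end QuasiPeriodic

/-! ### One constant for the whole nested family. -/

theorem mainTheorem1
    {D : Set Plane} (hD_open : IsOpen D) (hD_bounded : Bornology.IsBounded D)
    -- the inviscid quasi-periodic flow
    {m : ℕ} {Ω : Fin m → ℝ} {u : (Fin m → ℝ) → Plane → Plane}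
    (hu : IsQuasiPeriodicFlow 0 D Ω u)
    -- its nested family of invariant tori
    {ι : Type*} [LinearOrder ι] {T : ι → Set (ExtendedSpace m)}
    (hT : IsNestedFamilyOfInvariantTori D Ω u T)
    -- quasi-periodic viscous flows with viscosities tending to zero
    {ν : ℕ → ℝ} (hν_pos : ∀ k, 0 < ν k) (hν_lim : Tendsto ν atTop (𝓝 0))
    {n : ℕ → ℕ} {Λ : ∀ k, Fin (n k) → ℝ} {w : ∀ k, (Fin (n k) → ℝ) → Plane → Plane}
    (hw : ∀ k, IsQuasiPeriodicFlow (ν k) D (Λ k) (w k))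
    -- convergence to the inviscid flow in the regular limit
    {Θ : ℕ → Fin m → ℝ} (hΘ : Tendsto Θ atTop (𝓝 Ω))
    (hlim : ∀ i, IsRegularLimitOn u Θ (fun k t => w k (t • Λ k)) (filledRegion (T i))) :
    ∃ c : ℝ, ∀ i, ∀ (θ : Fin m → ℝ) (x : Plane),
      (x, phase θ) ∈ filledRegion (T i) → vorticity (u θ) x = c := by
  have hfill : ∀ i, ∃ c : ℝ, ∀ (θ : Fin m → ℝ) (x : Plane),
      (x, phase θ) ∈ filledRegion (T i) → vorticity (u θ) x = c := fun i => by
    obtain ⟨c, hc⟩ := hT.in_level_set i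
    exact ⟨c, vorticity_eq_on_filledRegion hD_open hD_bounded hu (hT.torus i).isClosed
      (hT.subset_domain i) hc hν_pos hw hΘ (hlim i)⟩
  choose c hc using hfill
  -- Any point of the inner torus lies in the volume enclosed by the outer one, so both constants
  -- are the vorticity there.
  have hlt : ∀ i j, i < j → c i = c j := fun i j hij => by
    obtain ⟨⟨x, η⟩, hq⟩ := (hT.torus i).nonempty
    obtain ⟨θ, rfl⟩ := (isOpenQuotientMap_phase m).surjective η
    rw [← hc i θ x (Or.inl hq), hc j θ x (Or.inr (hT.nested i j hij hq))]
  rcases isEmpty_or_nonempty ι with hι | ⟨⟨i₀⟩⟩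
  · exact ⟨0, fun i => hι.elim i⟩
  · refine ⟨c i₀, fun i θ x hx => (hc i θ x hx).trans ?_⟩
    rcases lt_trichotomy i i₀ with h | h | h
    · exact hlt _ _ h
    · rw [h]
    · exact (hlt _ _ h).symm
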